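/- Let $n$ be a natural number. A one-parameter family of hermiticity-preserving superoperators on $M_n(\mathbb C)$ is a function $t\mapsto\Phi_t$ from $\mathbb R$ to the $\mathbb C$-linear maps $M_n(\mathbb C)\to M_n(\mathbb C)$ for which there are $s\ge 1$, real polynomials $\alpha_1,\dots,\alpha_s\in\mathbb R[t]$ without real roots, and $n\times n$ matrices $A_1,\dots,A_s$ of complex polynomials in the real variable $t$ with $$\Phi_t(X)=\sum_{r=1}^{s}\alpha_r(t)\,A_r(t)\,X\,A_r(t)^{*}\qquad(t\in\mathbb R,\ X\in M_n(\mathbb C)).$$ A linear map on $M_n(\mathbb C)$ is positive if it maps positive semidefinite hermitian matrices to positive semidefinite hermitian matrices. The family $\Phi$ is globally nonpositive if no $\Phi_t$ is positive, locally nonpositive if there are real $u<v$ such that $\Phi_t$ is not positive for every $t\in(u,v)$, and pointwise nonpositive if some $\Phi_t$ is not positive. Let $\chi_\Phi\in\mathbb R[t][x]$ be the (unique) polynomial such that, for every $t\in\mathbb R$, $\chi_\Phi(t,x)=\det(M_t-xI)$, where $M_t=\sum_{i,j=1}^{n}E_{ij}\otimes\Phi_t(E_{ij})$ is the $n^2\times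 n^2$ Choi-Jamiołkowski matrix of $\Phi_t$, and put $f(t,x)=\chi_\Phi^-(t,x)=\chi_\Phi(t,-x)$. Let $(b_k,\dots,b_0)$ be the coefficient sequence of $f$, that is, the sequence of the nonzero coefficients $b_i\in\mathbb R[t]$ of $f$ as a polynomial in $x$, ordered by decreasing power of $x$. For a word $\sigma=\sigma_k\cdots\sigma_0$ over $\{+,-\}$, let $\lambda(\sigma)$ be the number of pairs of consecutive letters of $\sigma$ that are different. The sign variation formula $\varphi(t)$ of type $\sigma$ for $f$ is the conjunction $b_k(t)\,\Delta_k\,0\wedge\dots\wedge b_0(t)\,\Delta_0\,0$, where $\Delta_i$ is $>$ if $\sigma_i=+$ and $<$ if $\sigma_i=-$. Its normal form is $a_k(t)>0\wedge\dots\wedge a_0(t)>0$, where $a_i=b_i$ if $\sigma_i=+$ and $a_i=-b_i$ if $\sigma_i=-$. For polynomials $p,q\in\mathbb R[t]$ with $p\ne0$ let $N(p,q)=|\{x\in\mathbb R: p(x)=0,\ q(x)>0\}|-|\{x\in\mathbb R: p(x)=0,\ q(x)<0\}|$; in particular $N(p,\mathbf 1)$ is the number of distinct real roots of $p$. For polynomials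 $g,a_k,\dots,a_0\in\mathbb R[t]$ let $\mathcal S(g,a_k,\dots,a_0)=\{t\in\mathbb R: g(t)=0,\ a_k(t)>0,\dots,a_0(t)>0\}$. Theorem. Let $\Phi$ be a one-parameter family of hermiticity-preserving superoperators on $M_n(\mathbb C)$, let $f=\chi_\Phi^-$, let $\varphi$ be the sign variation formula of type $\sigma$ for $f$, where $\lambda(\sigma)\ge n^2-2n+2$, and let $a_k(t)>0\wedge\dots\wedge a_0(t)>0$ be the normal form of $\varphi$. (1) If $N(a_i,\mathbf 1)=0$ and $a_i(0)>0$ for all $i=0,\dots,k$, then $\Phi$ is globally nonpositive. (2) If at least one of the following conditions holds, then $\Phi$ is pointwise nonpositive and locally nonpositive: (2.1) $\lim_{t\to\infty}a_i(t)=\infty$ for all $i=0,\dots,k$; (2.2) $\lim_{t\to-\infty}a_i(t)=\infty$ for all $i=0,\dots,k$; (2.3) $|\mathcal S((a_k\cdots a_0)',a_k,\dots,a_0)|\ne 0$. -/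

import Mathlib

open Polynomial Filter
open scoped Kronecker ComplexOrder

noncomputable section

namespace SuperFamily

/-- Superoperators: the complex-linear maps on complex `n × n` matrices. -/
abbrev Superoperator (n : ℕ) : Type :=
  Matrix (Fin n) (Fin n) ℂ →ₗ[ℂ] Matrix (Fin n) (Fin n) ℂ

/-- A superoperator is positive if it sends positive semidefinite (hermitian) matrices to
positive semidefinite (hermitian) matrices. -/
def Superoperator.IsPositive {n : ℕ} (Ψ : Superoperator n) : Prop :=
  ∀ X : Matrix (Fin n) (Fin n) ℂ, X.PosSemidef → (Ψ X).PosSemidef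

/-- The Choi-Jamiolkowski matrix `∑ i j, E_ij ⊗ Ψ (E_ij)`, whose blocks are the `Ψ (E_ij)`. -/
def cjMatrix {n : ℕ} (Ψ : Superoperator n) : Matrix (Fin n × Fin n) (Fin n × Fin n) ℂ :=
  ∑ i : Fin n, ∑ j : Fin n, Matrix.single i j (1 : ℂ) ⊗ₖ Ψ (Matrix.single i j (1 : ℂ))

/-- The polynomial `det (M - x I)` of a square matrix `M` (over a commutative ring). This differs
from `Matrix.charpoly`, which is `det (x I - M)`, by the sign `(-1) ^ size`. -/
def detSubX {R m : Type*} [CommRing R] [Fintype m] [DecidableEq m] (M : Matrix m m R) : R[X] :=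
  (M.map (C : R → R[X]) - (X : R[X]) • (1 : Matrix m m R[X])).det

/-- The characteristic polynomial `det (M - x I)` of the Choi-Jamiolkowski matrix `M` of `Ψ`. -/
def superCharPoly {n : ℕ} (Ψ : Superoperator n) : ℂ[X] := detSubX (cjMatrix Ψ)

/-- One-parameter families of hermiticity-preserving superoperators: functions `t ↦ Φ t` that can
be written as `Φ t X = ∑ r, α_r(t) A_r(t) X A_r(t)^*`, with `s ≥ 1` terms, real polynomials
`α_r` without real roots and matrices `A_r` of complex polynomials in the real variable `t`. -/
structure OneParameterFamily (n : ℕ) where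
  toFun : ℝ → Superoperator n
  exists_rep : ∃ (s : ℕ) (α : Fin s → ℝ[X]) (A : Fin s → Matrix (Fin n) (Fin n) ℂ[X]),
    1 ≤ s ∧ (∀ r, ∀ t : ℝ, (α r).eval t ≠ 0) ∧
    ∀ (t : ℝ) (X : Matrix (Fin n) (Fin n) ℂ),
      toFun t X = ∑ r, (((α r).eval t : ℝ) : ℂ) •
        ((A r).map (fun p => p.eval (t : ℂ)) * X *
          ((A r).map (fun p => p.eval (t : ℂ))).conjTranspose)

namespace OneParameterFamily

variable {n : ℕ}

/-- No `Φ t` is positive. -/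
def GloballyNonpositive (Φ : OneParameterFamily n) : Prop :=
  ∀ t : ℝ, ¬ (Φ.toFun t).IsPositive

/-- `Φ t` is not positive for all `t` in some (nonempty) open interval. -/
def LocallyNonpositive (Φ : OneParameterFamily n) : Prop :=
  ∃ u v : ℝ, u < v ∧ ∀ t ∈ Set.Ioo u v, ¬ (Φ.toFun t).IsPositive

/-- Some `Φ t` is not positive. -/
def PointwiseNonpositive (Φ : OneParameterFamily n) : Prop :=
  ∃ t : ℝ, ¬ (Φ.toFun t).IsPositive

end OneParameterFamily

/-! ### The bivariate characteristic polynomial is well defined -/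

theorem detSubX_map {R S m : Type*} [CommRing R] [CommRing S] [Fintype m] [DecidableEq m]
    (g : R →+* S) (M : Matrix m m R) : (detSubX M).map g = detSubX (M.map g) := by
  have h := RingHom.map_det (mapRingHom g) (M.map (C : R → R[X]) - (X : R[X]) • (1 : Matrix m m R[X]))
  rw [coe_mapRingHom] at h
  rw [detSubX, h, detSubX]
  congr 1
  ext1 i j
  by_cases hij : i = j <;> simp [hij]

theorem detSubX_transpose {R m : Type*} [CommRing R] [Fintype m] [DecidableEq m]
    (M : Matrix m m R) : detSubX M.transpose = detSubX M := by
  rw [detSubX, detSubX, ← Matrix.det_transpose]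
  congr 1
  ext1 i j
  simp [Matrix.one_apply, eq_comm]

theorem cjMatrix_apply {n : ℕ} (Ψ : Superoperator n) (p q : Fin n × Fin n) :
    cjMatrix Ψ p q = Ψ (Matrix.single p.1 q.1 1) p.2 q.2 := by
  simp only [cjMatrix, Matrix.sum_apply, Matrix.kroneckerMap_apply, Matrix.single_apply, ite_and,
    ite_mul, one_mul, zero_mul]
  rw [Finset.sum_eq_single p.1, Finset.sum_eq_single q.1] <;> simp +contextual

/-- There is exactly one polynomial `χ ∈ ℝ[t][x]` whose specialization at every real `t` is the
characteristic polynomial of `Φ t`. -/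
theorem OneParameterFamily.existsUnique_charPoly {n : ℕ} (Φ : OneParameterFamily n) :
    ∃! χ : ℝ[X][X], ∀ t : ℝ,
      (χ.map (evalRingHom t)).map (algebraMap ℝ ℂ) = superCharPoly (Φ.toFun t) := by
  refine existsUnique_of_exists_of_unique ?_ ?_
  · obtain ⟨s, α, A, -, -, hΦ⟩ := Φ.exists_rep
    let P : Matrix (Fin n × Fin n) (Fin n × Fin n) ℂ[X] := fun p q =>
      ∑ r, (α r).map (algebraMap ℝ ℂ) * (A r p.2 p.1 * (A r q.2 q.1).map (starRingEnd ℂ))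
    have hPapp : ∀ p q, P p q = ∑ r, (α r).map (algebraMap ℝ ℂ) *
        (A r p.2 p.1 * (A r q.2 q.1).map (starRingEnd ℂ)) := fun _ _ => rfl
    have hP : P.map (mapRingHom (starRingEnd ℂ)) = P.transpose := by
      ext1 p q
      rw [Matrix.map_apply, Matrix.transpose_apply, hPapp, hPapp, map_sum]
      simp only [map_mul, coe_mapRingHom, Polynomial.map_map]
      refine Finset.sum_congr rfl fun r _ => ?_
      have h1 : (starRingEnd ℂ).comp (algebraMap ℝ ℂ) = algebraMap ℝ ℂ := by
        ext x; simp
      have h2 : (starRingEnd ℂ).comp (starRingEnd ℂ) = RingHom.id ℂ := by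
        ext x; simp
      rw [h1, h2, Polynomial.map_id, mul_comm (A r q.2 q.1)]
    have hQ : (detSubX P).map (mapRingHom (starRingEnd ℂ)) = detSubX P := by
      rw [detSubX_map, hP, detSubX_transpose]
    have hlift : detSubX P ∈ lifts (mapRingHom (algebraMap ℝ ℂ)) := by
      rw [lifts_iff_coeff_lifts]
      intro k
      have hk : ((detSubX P).coeff k).map (starRingEnd ℂ) = (detSubX P).coeff k := by
        conv_rhs => rw [← hQ]
        rw [coeff_map, coe_mapRingHom]
      have : (detSubX P).coeff k ∈ lifts (algebraMap ℝ ℂ) := by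
        rw [lifts_iff_coeff_lifts]
        intro l
        have hl : starRingEnd ℂ (((detSubX P).coeff k).coeff l) = ((detSubX P).coeff k).coeff l := by
          conv_rhs => rw [← hk]
          rw [coeff_map]
        exact ⟨_, Complex.conj_eq_iff_re.mp hl⟩
      rw [mem_lifts] at this
      exact this
    rw [mem_lifts] at hlift
    obtain ⟨χ, hχ⟩ := hlift
    refine ⟨χ, fun t => ?_⟩
    have hcomp : (algebraMap ℝ ℂ).comp (evalRingHom t) =
        (evalRingHom (t : ℂ)).comp (mapRingHom (algebraMap ℝ ℂ)) := by
      ext x <;> simp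
    rw [Polynomial.map_map, hcomp, ← Polynomial.map_map, hχ, detSubX_map, superCharPoly]
    congr 1
    ext1 p q
    have hc : ∀ f : ℂ[X], (f.map (starRingEnd ℂ)).eval (t : ℂ) = starRingEnd ℂ (f.eval (t : ℂ)) := by
      intro f
      have := Polynomial.eval_map_apply (starRingEnd ℂ) (t : ℂ) (p := f)
      simpa using this
    have ha : ∀ f : ℝ[X], (f.map (algebraMap ℝ ℂ)).eval (t : ℂ) = ((f.eval t : ℝ) : ℂ) := by
      intro f
      simpa using Polynomial.eval_map_apply (algebraMap ℝ ℂ) t (p := f)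
    rw [cjMatrix_apply, hΦ]
    rw [Matrix.map_apply, hPapp, map_sum, Matrix.sum_apply]
    simp only [map_mul, coe_evalRingHom, hc, ha, Matrix.smul_apply, smul_eq_mul]
    refine Finset.sum_congr rfl fun r _ => ?_
    congr 1
    simp [Matrix.mul_apply, Matrix.single_apply, ite_and]
  · intro χ χ' h h'
    ext1 k
    refine Polynomial.funext fun t => ?_
    have := (Polynomial.map_injective _ (algebraMap ℝ ℂ).injective) ((h t).trans (h' t).symm)
    simpa using congrArg (fun f => f.coeff k) this

/-- The characteristic polynomial `χ_Φ ∈ ℝ[t][x]` of a one-parameter family. The inner variable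
is `t`, the outer variable is `x`. -/
def OneParameterFamily.charPoly {n : ℕ} (Φ : OneParameterFamily n) : ℝ[X][X] :=
  Φ.existsUnique_charPoly.choose

theorem OneParameterFamily.charPoly_spec {n : ℕ} (Φ : OneParameterFamily n) (t : ℝ) :
    (Φ.charPoly.map (evalRingHom t)).map (algebraMap ℝ ℂ) = superCharPoly (Φ.toFun t) :=
  Φ.existsUnique_charPoly.choose_spec.1 t

/-- The reflected polynomial `χ_Φ^-(t, x) = χ_Φ(t, -x)`. -/
def OneParameterFamily.reflCharPoly {n : ℕ} (Φ : OneParameterFamily n) : ℝ[X][X] :=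
  Φ.charPoly.comp (-X)

/-! ### Words in the letters `+`, `-` and sign variation formulas -/

/-- The alphabet `{+, -}`. -/
inductive Letter : Type
  | plus
  | minus
  deriving DecidableEq

/-- The number of sign variations of a word: the number of its subwords (of two consecutive
letters) of the form `+-` or `-+`. -/
def signVar : List Letter → ℕ
  | [] => 0
  | [_] => 0
  | a :: b :: w => (if a = b then 0 else 1) + signVar (b :: w)

/-- Sign variation formulas in one free variable `t`. `comp ε a` is the formula `a(t) > 0` or
`a(t) < 0` according to the letter `ε`, and `conj φ ε a` is the conjunction of the
formula `φ` with that component. -/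
inductive SVFormula : Type
  | comp (ε : Letter) (a : ℝ[X]) : SVFormula
  | conj (φ : SVFormula) (ε : Letter) (a : ℝ[X]) : SVFormula

namespace SVFormula

/-- The type of a formula, as a word read from left to right. -/
def type : SVFormula → List Letter
  | comp ε _ => [ε]
  | conj φ ε _ => φ.type ++ [ε]

/-- The domain `(a_k, …, a_0)` of a formula. -/
def domain : SVFormula → List ℝ[X]
  | comp _ a => [a]
  | conj φ _ a => φ.domain ++ [a]

/-- The polynomial `b` such that the component given by `ε` and `a` is equivalent to
`b(t) > 0`: it is `a` for a positive component and `-a` for a negative one. -/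
def normalPoly : Letter → ℝ[X] → ℝ[X]
  | Letter.plus, a => a
  | Letter.minus, a => -a

/-- The normal form: every negative component `a(t) < 0` is replaced by `(-a)(t) > 0`. -/
def normalForm : SVFormula → SVFormula
  | comp ε a => comp Letter.plus (normalPoly ε a)
  | conj φ ε a => conj φ.normalForm Letter.plus (normalPoly ε a)

end SVFormula

/-- The coefficient sequence of `f ∈ ℝ[t][x]`: its nonzero coefficients (which are polynomials
in `t`), ordered by decreasing degree in `x`. -/
def coeffSeq (f : ℝ[X][X]) : List ℝ[X] :=
  (f.support.sort (· ≥ ·)).map f.coeff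

/-- `φ` is a sign variation formula of type `σ` for `f`. -/
def SVFormula.IsFor (φ : SVFormula) (σ : List Letter) (f : ℝ[X][X]) : Prop :=
  φ.type = σ ∧ φ.domain = coeffSeq f

/-! ### Counting roots -/

/-- `N(p, q) = #{x | p(x) = 0, q(x) > 0} - #{x | p(x) = 0, q(x) < 0}`, for nonzero `p`
(so that both sets are finite). -/
def rootDiff (p q : ℝ[X]) : ℤ :=
  ({x : ℝ | p.eval x = 0 ∧ 0 < q.eval x}.ncard : ℤ) -
    ({x : ℝ | p.eval x = 0 ∧ q.eval x < 0}.ncard : ℤ)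

/-- `S(f, a_k, …, a_0) = {t | f(t) = 0, a_k(t) > 0, …, a_0(t) > 0}`. -/
def rootSetPos (f : ℝ[X]) (as : List ℝ[X]) : Set ℝ :=
  {t : ℝ | f.eval t = 0 ∧ ∀ a ∈ as, 0 < a.eval t}

end SuperFamily

end

/-!
If a superoperator `Ψ` is positive, its Choi-Jamiolkowski matrix `M` is hermitian and the form
`v ↦ v* M v` is nonnegative on product vectors `v = a ⊗ b`, because its value there is
`b* Ψ(conj(a) aᵀ) b`. On the span of the eigenvectors of `M` with negative eigenvalues the form is
negative definite, so that this span contains no nonzero product vector. Every subspace of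
`ℂⁿ ⊗ ℂⁿ` of dimension greater than `(n - 1)²` contains one (`Segre.exists_product_mem`), hence `M`
has at most `(n - 1)²` negative eigenvalues
(`SuperFamily.Superoperator.IsPositive.card_neg_eigenvalues_le`).

The existence of product vectors is the projective dimension theorem for the Segre variety. In the
coordinate ring of the affine cone over the Segre variety the vertex has height at least `2 n - 1`,
by an explicit chain of coordinate primes. If a subspace of codimension `d` met the cone only in the
vertex, then by the Nullstellensatz the vertex would be a minimal prime over `d` linear forms, and
Krull's height theorem would give `d ≥ 2 n - 1`, that is, dimension at most `(n - 1)²`.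

For fixed `t`, the polynomial `χ⁻(t, ·)` is `∏ (x + λ_i)` over the eigenvalues `λ_i` of `M_t`, so
its positive roots are the `-λ_i` with `λ_i < 0`. All its roots are real, and for such polynomials
Descartes' rule of signs is sharp (`Polynomial.signVariations_le_countP_pos_of_splits`): the sign
variations of `p(x)` and `p(-x)` together number at most the degree minus the multiplicity of the
root `0`, while Descartes bounds the number of negative roots by the sign variations of `p(-x)`.
Hence, wherever the sign variation formula holds, `M_t` has at least `n² - 2 n + 2` negative
eigenvalues and `Φ t` is not positive (`SuperFamily.not_isPositive_of_normalForm_pos`). It remains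
to see that the assumptions of the theorem make the normal form hold at every `t`, or at some `t`
and then, by continuity, on an open interval around it.
-/

/-! ### Product vectors in subspaces of large dimension -/

namespace Segre

variable {ι κ : Type*}

variable (ι κ) in
/-- The comorphism `z (i, j) ↦ x i * y j` of the Segre map. -/
noncomputable def comorphism : MvPolynomial (ι × κ) ℂ →ₐ[ℂ] MvPolynomial (ι ⊕ κ) ℂ :=
  MvPolynomial.aeval fun p => MvPolynomial.X (Sum.inl p.1) * MvPolynomial.X (Sum.inr p.2)

variable (ι κ) in
/-- The homogeneous coordinate ring of the Segre variety, that is, the coordinate ring of the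
affine cone of matrices of rank at most one. -/
abbrev CoordRing : Type _ := MvPolynomial (ι × κ) ℂ ⧸ RingHom.ker (comorphism ι κ)

/-- A zero of the ideal of the Segre cone satisfies the equations given by the `2 × 2` minors,
and hence is a product vector. -/
theorem eq_product_of_mem_zeroLocus {x : ι × κ → ℂ}
    (hx : ∀ r ∈ RingHom.ker (comorphism ι κ), MvPolynomial.aeval x r = 0) (hx0 : x ≠ 0) :
    ∃ (a : ι → ℂ) (b : κ → ℂ), a ≠ 0 ∧ b ≠ 0 ∧ x = fun p => a p.1 * b p.2 := by
  obtain ⟨⟨i, j⟩, hij⟩ := Function.ne_iff.1 hx0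
  rw [Pi.zero_apply] at hij
  refine ⟨fun k => x (k, j), fun l => x (i, l) / x (i, j), fun h => hij (congrFun h i),
    fun h => by simpa [hij] using congrFun h j, ?_⟩
  funext ⟨k, l⟩
  have := hx (MvPolynomial.X (k, l) * MvPolynomial.X (i, j) -
    MvPolynomial.X (k, j) * MvPolynomial.X (i, l)) (by
      rw [RingHom.mem_ker]
      simp only [comorphism, map_sub, map_mul, MvPolynomial.aeval_X]
      ring)
  simp only [map_sub, map_mul, MvPolynomial.aeval_X] at this
  field_simp
  linear_combination this

variable [DecidableEq ι] [DecidableEq κ]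

/-- The endomorphism of `ℂ[x, y]` which keeps the variables `x i` with `i ∈ I` and `y j` with
`j ∈ K` and sends all the other variables to zero. -/
noncomputable def restrict (I : Finset ι) (K : Finset κ) :
    MvPolynomial (ι ⊕ κ) ℂ →ₐ[ℂ] MvPolynomial (ι ⊕ κ) ℂ :=
  MvPolynomial.aeval (Sum.elim
    (fun i => if i ∈ I then MvPolynomial.X (Sum.inl i) else 0)
    (fun j => if j ∈ K then MvPolynomial.X (Sum.inr j) else 0))

theorem restrict_comp_restrict {I I' : Finset ι} {K K' : Finset κ} (hI : I ⊆ I') (hK : K ⊆ K') :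
    (restrict I K).comp (restrict I' K') = restrict I K := by
  apply MvPolynomial.algHom_ext
  rintro (i | j)
  · by_cases h : i ∈ I
    · simp [restrict, h, hI h]
    · by_cases h' : i ∈ I' <;> simp [restrict, h, h']
  · by_cases h : j ∈ K
    · simp [restrict, h, hK h]
    · by_cases h' : j ∈ K' <;> simp [restrict, h, h']

/-- The ring homomorphism induced on the coordinate ring by `z (i, j) ↦ x i * y j`,
restricted to the coordinate subspaces given by `I` and `K`. -/
noncomputable def restrictHom (I : Finset ι) (K : Finset κ) :
    CoordRing ι κ →+* MvPolynomial (ι ⊕ κ) ℂ :=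
  Ideal.Quotient.lift _ ((restrict I K).comp (comorphism ι κ)).toRingHom fun r hr => by
    rw [RingHom.mem_ker] at hr
    simp [hr]

theorem restrictHom_mk (I : Finset ι) (K : Finset κ) (r : MvPolynomial (ι × κ) ℂ) :
    restrictHom I K (Ideal.Quotient.mk _ r) = restrict I K (comorphism ι κ r) := rfl

theorem restrictHom_empty_mk (r : MvPolynomial (ι × κ) ℂ) :
    restrictHom (∅ : Finset ι) (∅ : Finset κ) (Ideal.Quotient.mk _ r) =
      MvPolynomial.C (MvPolynomial.aeval (0 : ι × κ → ℂ) r) := by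
  have : (restrict (∅ : Finset ι) (∅ : Finset κ)).comp (comorphism ι κ) =
      (Algebra.ofId ℂ (MvPolynomial (ι ⊕ κ) ℂ)).comp (MvPolynomial.aeval (0 : ι × κ → ℂ)) := by
    apply MvPolynomial.algHom_ext
    intro p
    simp [restrict, comorphism]
  rw [restrictHom_mk]
  exact DFunLike.congr_fun this r

instance ker_restrictHom_isPrime (I : Finset ι) (K : Finset κ) :
    (RingHom.ker (restrictHom I K)).IsPrime :=
  RingHom.ker_isPrime _

theorem ker_restrictHom_anti {I I' : Finset ι} {K K' : Finset κ} (hI : I ⊆ I') (hK : K ⊆ K') :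
    RingHom.ker (restrictHom I' K') ≤ RingHom.ker (restrictHom I K) := by
  intro s hs
  obtain ⟨r, rfl⟩ := Ideal.Quotient.mk_surjective s
  rw [RingHom.mem_ker, restrictHom_mk] at hs ⊢
  rw [← restrict_comp_restrict hI hK, AlgHom.comp_apply, hs, map_zero]

theorem mk_X_mem_ker_restrictHom (I : Finset ι) (K : Finset κ) (i : ι) (j : κ) :
    Ideal.Quotient.mk _ (MvPolynomial.X (i, j)) ∈ RingHom.ker (restrictHom I K) ↔
      i ∉ I ∨ j ∉ K := by
  rw [RingHom.mem_ker, restrictHom_mk]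
  by_cases hi : i ∈ I <;> by_cases hj : j ∈ K <;>
    simp [comorphism, restrict, hi, hj, MvPolynomial.X_ne_zero]

theorem ker_restrictHom_lt {I I' : Finset ι} {K K' : Finset κ} (hI : I ⊆ I') (hK : K ⊆ K')
    {i : ι} {j : κ} (hi : i ∈ I') (hj : j ∈ K') (h : i ∉ I ∨ j ∉ K) :
    RingHom.ker (restrictHom I' K') < RingHom.ker (restrictHom I K) := by
  refine lt_of_le_of_ne (ker_restrictHom_anti hI hK) fun heq => ?_
  have := (mk_X_mem_ker_restrictHom I K i j).2 h
  rw [← heq, mk_X_mem_ker_restrictHom] at this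
  tauto

variable [Fintype ι] [Fintype κ]

/-- Adding indices to `I` and `K` one at a time gives a chain of primes below the kernel. -/
theorem le_height_ker_restrictHom (c : ℕ) :
    ∀ (I : Finset ι) (K : Finset κ), I.Nonempty → K.Nonempty → Iᶜ.card + Kᶜ.card = c →
      (c : ℕ∞) ≤ (RingHom.ker (restrictHom I K)).height := by
  induction c with
  | zero => intros; simp
  | succ c ih =>
    intro I K hI hK hc
    obtain ⟨i, hi⟩ | ⟨j, hj⟩ : Iᶜ.Nonempty ∨ Kᶜ.Nonempty := by
      by_contra! h
      simp [h.1, h.2] at hc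
    · have h1 := ih (insert i I) K (Finset.insert_nonempty i I) hK (by
        rw [Finset.compl_insert, Finset.card_erase_of_mem hi]
        have := Finset.card_pos.2 ⟨i, hi⟩
        omega)
      obtain ⟨j, hj⟩ := hK
      have := Ideal.height_add_one_le_of_lt_of_isPrime
        (ker_restrictHom_lt (Finset.subset_insert i I) subset_rfl (Finset.mem_insert_self i I) hj
          (Or.inl (Finset.mem_compl.1 hi)))
      push_cast
      exact (add_le_add_left h1 1).trans this
    · have h1 := ih I (insert j K) hI (Finset.insert_nonempty j K) (by
        rw [Finset.compl_insert, Finset.card_erase_of_mem hj]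
        have := Finset.card_pos.2 ⟨j, hj⟩
        omega)
      obtain ⟨i, hi⟩ := hI
      have := Ideal.height_add_one_le_of_lt_of_isPrime
        (ker_restrictHom_lt subset_rfl (Finset.subset_insert j K) hi (Finset.mem_insert_self j K)
          (Or.inr (Finset.mem_compl.1 hj)))
      push_cast
      exact (add_le_add_left h1 1).trans this

/-- The vertex of the Segre cone, whose prime ideal is the kernel for `I = K = ∅`, has height at
least `|ι| + |κ| - 1`. -/
theorem le_height_vertex [Nonempty ι] [Nonempty κ] :
    ((Fintype.card ι + Fintype.card κ - 1 : ℕ) : ℕ∞) ≤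
      (RingHom.ker (restrictHom (∅ : Finset ι) (∅ : Finset κ))).height := by
  obtain ⟨i⟩ := ‹Nonempty ι›
  obtain ⟨j⟩ := ‹Nonempty κ›
  have h1 := le_height_ker_restrictHom _ {i} {j} (Finset.singleton_nonempty i)
    (Finset.singleton_nonempty j) rfl
  have h2 := Ideal.height_add_one_le_of_lt_of_isPrime
    (ker_restrictHom_lt (Finset.empty_subset {i}) (Finset.empty_subset {j})
      (Finset.mem_singleton_self i) (Finset.mem_singleton_self j) (Or.inl (Finset.notMem_empty i)))
  -- `(|ι| - 1) + (|κ| - 1)` steps lead down from `I = {i}`, `K = {j}`, and one more step from there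
  -- up to the vertex.
  refine le_trans ?_ ((add_le_add_left h1 1).trans h2)
  have hi : 0 < Fintype.card ι := Fintype.card_pos_iff.2 ⟨i⟩
  have hj : 0 < Fintype.card κ := Fintype.card_pos_iff.2 ⟨j⟩
  rw [Finset.card_compl, Finset.card_compl, Finset.card_singleton, Finset.card_singleton]
  norm_cast
  omega

/-- A linear subspace of `ℂ^ι ⊗ ℂ^κ` of dimension greater than `(|ι| - 1) (|κ| - 1)` contains a
nonzero product vector. This is the projective dimension theorem for the Segre variety and a linear
subspace. -/
theorem exists_product_mem [Nonempty ι] [Nonempty κ] (W : Submodule ℂ (ι × κ → ℂ))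
    (hW : Fintype.card ι * Fintype.card κ + 2 ≤
      Module.finrank ℂ W + Fintype.card ι + Fintype.card κ) :
    ∃ (a : ι → ℂ) (b : κ → ℂ), a ≠ 0 ∧ b ≠ 0 ∧ (fun p : ι × κ => a p.1 * b p.2) ∈ W := by
  by_contra! hcon
  have hfin : Module.finrank ℂ W + Module.finrank ℂ W.dualAnnihilator =
      Fintype.card ι * Fintype.card κ := by
    rw [Subspace.finrank_add_finrank_dualAnnihilator_eq, Module.finrank_fintype_fun_eq_card,
      Fintype.card_prod]
  let l := Module.finBasis ℂ W.dualAnnihilator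
  let L : Fin (Module.finrank ℂ W.dualAnnihilator) → MvPolynomial (ι × κ) ℂ := fun k =>
    ∑ p, MvPolynomial.C ((l k : Module.Dual ℂ (ι × κ → ℂ)) (Pi.single p 1)) * MvPolynomial.X p
  have hL : ∀ k x, MvPolynomial.aeval x (L k) = (l k : Module.Dual ℂ (ι × κ → ℂ)) x := by
    intro k x
    conv_rhs => rw [← Finset.univ_sum_single x]
    simp only [L, map_sum, map_mul, MvPolynomial.aeval_X, MvPolynomial.aeval_C,
      Algebra.algebraMap_self, RingHom.id_apply]
    refine Finset.sum_congr rfl fun p _ => ?_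
    rw [mul_comm, ← smul_eq_mul, ← map_smul, ← Pi.single_smul, smul_eq_mul, mul_one]
  -- The linear forms `L k` cut out `W`.
  have hLW : ∀ x, (∀ k, MvPolynomial.aeval x (L k) = 0) → x ∈ W := by
    intro x hx
    rw [← Subspace.dualAnnihilator_dualCoannihilator_eq (W := W), Submodule.mem_dualCoannihilator]
    intro g hg
    have := l.sum_repr ⟨g, hg⟩
    have := congrArg (fun g : W.dualAnnihilator => (g : Module.Dual ℂ (ι × κ → ℂ)) x) this
    simp only [Submodule.coe_sum, Submodule.coe_smul, LinearMap.sum_apply,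
      LinearMap.smul_apply] at this
    rw [← this]
    exact Finset.sum_eq_zero fun k _ => by rw [← hL, hx, smul_zero]
  -- If `W` has no nonzero product vectors, the vertex is minimal over the classes of the `L k`.
  set s : Set (CoordRing ι κ) := Set.range fun k => Ideal.Quotient.mk _ (L k) with hs
  have hmin : RingHom.ker (restrictHom (∅ : Finset ι) (∅ : Finset κ)) ∈
      (Ideal.span s).minimalPrimes := by
    refine ⟨⟨RingHom.ker_isPrime _, ?_⟩, ?_⟩
    · rw [Ideal.span_le]
      rintro _ ⟨k, rfl⟩
      rw [SetLike.mem_coe, RingHom.mem_ker, restrictHom_empty_mk, hL, map_zero, map_zero]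
    · rintro P ⟨hP, hsP⟩ - t ht
      obtain ⟨r, rfl⟩ := Ideal.Quotient.mk_surjective t
      rw [RingHom.mem_ker, restrictHom_empty_mk, MvPolynomial.C_eq_zero] at ht
      have hP' := Ideal.comap_isPrime (Ideal.Quotient.mk (RingHom.ker (comorphism ι κ))) P
      -- By the Nullstellensatz it is enough that `r` vanishes on the zeros of the contraction of
      -- `P`, and these are product vectors in `W`.
      suffices h : r ∈ P.comap (Ideal.Quotient.mk (RingHom.ker (comorphism ι κ))) from h
      rw [← MvPolynomial.IsPrime.vanishingIdeal_zeroLocus (K := ℂ)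
        (P.comap (Ideal.Quotient.mk (RingHom.ker (comorphism ι κ)))),
        MvPolynomial.mem_vanishingIdeal_iff]
      intro x hx
      rw [MvPolynomial.mem_zeroLocus_iff] at hx
      by_cases hx0 : x = 0
      · rwa [hx0]
      obtain ⟨a, b, ha, hb, rfl⟩ := eq_product_of_mem_zeroLocus (fun r hr => hx r (by
        rw [Ideal.mem_comap, Ideal.Quotient.eq_zero_iff_mem.2 hr]
        exact P.zero_mem)) hx0
      refine absurd (hLW _ fun k => hx _ ?_) (hcon a b ha hb)
      exact hsP (Ideal.subset_span ⟨k, rfl⟩)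
  have h1 := Ideal.height_le_card_of_mem_minimalPrimes_span (Set.finite_range _) hmin
  have h2 : s.ncard ≤ Module.finrank ℂ W.dualAnnihilator := by
    rw [← Set.image_univ] at hs
    rw [hs]
    refine (Set.ncard_image_le Set.finite_univ).trans ?_
    simp
  have h3 := (le_height_vertex (ι := ι) (κ := κ)).trans h1
  have h4 : Fintype.card ι + Fintype.card κ - 1 ≤ s.ncard := by exact_mod_cast h3
  have hi : 0 < Fintype.card ι := Fintype.card_pos
  omega

end Segre

/-! ### Descartes' rule of signs for real-rooted polynomials -/

namespace Polynomial

theorem comp_neg_X_coeff (p : ℝ[X]) (k : ℕ) : (p.comp (-X)).coeff k = p.coeff k * (-1) ^ k := by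
  rw [← comp_C_mul_X_coeff, map_neg, map_one, neg_one_mul]

theorem eraseLead_comp_neg_X (p : ℝ[X]) : (p.comp (-X)).eraseLead = p.eraseLead.comp (-X) := by
  ext k
  rw [comp_neg_X_coeff, eraseLead_coeff, eraseLead_coeff, natDegree_comp, natDegree_neg,
    natDegree_X, mul_one, comp_neg_X_coeff]
  split_ifs <;> simp

/-- Between two consecutive nonzero terms of degrees `d > d'`, the coefficients of `p(X)` and of
`p(-X)` change sign at most twice in total, and exactly once if `d = d' + 1`. -/
theorem signVariations_add_comp_neg_X_le (p : ℝ[X]) :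
    p.signVariations + (p.comp (-X)).signVariations + p.natTrailingDegree ≤ p.natDegree := by
  induction h : p.support.card using Nat.strong_induction_on generalizing p with | _ c ih =>
  by_cases hp : p = 0
  · simp [hp]
  have hp' : p.comp (-X) ≠ 0 := by
    intro h0
    apply hp
    ext k
    have := congrArg (fun q => q.coeff k) h0
    simpa [comp_neg_X_coeff] using this
  rw [signVariations_eq_eraseLead_add_ite hp, signVariations_eq_eraseLead_add_ite hp',
    eraseLead_comp_neg_X]
  by_cases hq : p.eraseLead = 0
  · have := natTrailingDegree_le_natDegree p
    simp [hq, hp, this]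
  have hlt : p.eraseLead.natDegree < p.natDegree := by
    refine (eraseLead_natDegree_lt_or_eraseLead_eq_zero p).resolve_right hq
  have hle : p.natTrailingDegree ≤ p.eraseLead.natTrailingDegree := by
    apply natTrailingDegree_le_of_ne_zero
    intro h0
    apply (trailingCoeff_nonzero_iff_nonzero (p := p.eraseLead)).2 hq
    rw [trailingCoeff, eraseLead_coeff, h0, ite_self]
  have := ih _ (h ▸ eraseLead_support_card_lt hp) p.eraseLead rfl
  by_cases hd : p.eraseLead.natDegree + 1 = p.natDegree
  · have hxor : ¬ (SignType.sign p.leadingCoeff = -SignType.sign p.eraseLead.leadingCoeff ∧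
        SignType.sign (p.comp (-X)).leadingCoeff =
          -SignType.sign (p.eraseLead.comp (-X)).leadingCoeff) := by
      rintro ⟨h1, h2⟩
      rw [leadingCoeff_comp (by simp), leadingCoeff_comp (by simp), ← hd, leadingCoeff_neg,
        leadingCoeff_X, pow_succ, sign_mul, sign_mul, sign_mul, h1] at h2
      have h3 : SignType.sign p.eraseLead.leadingCoeff ≠ 0 := by simpa using hq
      have h4 : SignType.sign ((-1 : ℝ) ^ p.eraseLead.natDegree) ≠ 0 := by simp
      rw [show SignType.sign (-1 : ℝ) = -1 by simp] at h2
      revert h2 h3 h4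
      generalize SignType.sign p.eraseLead.leadingCoeff = u
      generalize SignType.sign ((-1 : ℝ) ^ p.eraseLead.natDegree) = v
      revert u v
      decide
    split_ifs <;> first | omega | tauto
  · split_ifs <;> omega

/-- The converse of Descartes' rule of signs for polynomials all of whose roots are real: there are
at least as many positive roots as sign variations. -/
theorem signVariations_le_countP_pos_of_splits {p : ℝ[X]} (hp : p.Splits) :
    p.signVariations ≤ p.roots.countP (0 < ·) := by
  have h1 := signVariations_add_comp_neg_X_le p
  have h2 := roots_countP_pos_le_signVariations (p.comp (-X))
  have h3 : (p.comp (-X)).roots = p.roots.map Neg.neg := by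
    ext a
    have h := rootMultiplicity_comp_C_mul_X_add_C p (-1) 0 a (by simp)
    simp only [map_neg, map_one, neg_mul, one_mul, map_zero, add_zero] at h
    conv_rhs => rw [← neg_neg a]
    rw [Multiset.count_map_eq_count' _ _ neg_injective, count_roots, count_roots, h]
  have h4 : p.natTrailingDegree = p.roots.count 0 := by
    rw [count_roots, rootMultiplicity_eq_natTrailingDegree']
  have h5 := hp.natDegree_eq_card_roots
  rw [h3, Multiset.countP_map, ← Multiset.countP_eq_card_filter] at h2
  simp only [Left.neg_pos_iff] at h2
  have h6 : p.roots.countP (0 < ·) + p.roots.countP (· < 0) + p.roots.count 0 =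
      Multiset.card p.roots := by
    generalize p.roots = m
    induction m using Multiset.induction_on with
    | empty => simp
    | cons a m ih =>
      rw [Multiset.card_cons, ← ih]
      simp only [Multiset.countP_cons, Multiset.count_cons]
      rcases lt_trichotomy a 0 with h | rfl | h
      · simp only [h, h.not_gt, h.ne', if_true, if_false]
        omega
      · simp only [lt_irrefl, if_true, if_false]
        omega
      · simp only [h, h.not_gt, h.ne, if_true, if_false]
        omega
  omega

end Polynomial

/-! ### Words of signs of coefficients -/

namespace SuperFamily

open Classical in
/-- The letter recording whether a nonzero real number is positive or negative (`0` gets the letter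
`minus`, and is excluded wherever this is used). -/
noncomputable def letterOf (x : ℝ) : Letter := if 0 < x then Letter.plus else Letter.minus

theorem letterOf_eq_iff {x y : ℝ} (hx : x ≠ 0) (hy : y ≠ 0) :
    letterOf x = letterOf y ↔ ¬ SignType.sign x = -SignType.sign y := by
  rcases hx.lt_or_gt with hx | hx <;> rcases hy.lt_or_gt with hy | hy <;>
    simp [letterOf, hx, hy, hx.not_gt, hy.not_gt]

theorem sort_support_eq_cons {p : ℝ[X]} (hp : p ≠ 0) :
    p.support.sort (· ≥ ·) = p.natDegree :: p.eraseLead.support.sort (· ≥ ·) := by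
  rw [eraseLead_support, ← Finset.sort_insert,
    Finset.insert_erase (natDegree_mem_support_of_nonzero hp)]
  · exact fun k hk => le_natDegree_of_mem_supp k (Finset.mem_of_mem_erase hk)
  · exact Finset.notMem_erase _ _

/-- The sign variations of the word of signs of the nonzero coefficients. -/
theorem signVar_letterOf (p : ℝ[X]) :
    signVar ((p.support.sort (· ≥ ·)).map fun k => letterOf (p.coeff k)) = p.signVariations := by
  induction h : p.support.card using Nat.strong_induction_on generalizing p with | _ c ih =>
  by_cases hp : p = 0
  · simp [hp, signVar]
  have hcongr : (p.eraseLead.support.sort (· ≥ ·)).map (fun k => letterOf (p.coeff k)) =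
      (p.eraseLead.support.sort (· ≥ ·)).map (fun k => letterOf (p.eraseLead.coeff k)) := by
    refine List.map_congr_left fun k hk => ?_
    rw [Finset.mem_sort] at hk
    rw [eraseLead_coeff_of_ne]
    rintro rfl
    exact natDegree_notMem_eraseLead_support hk
  have := ih _ (h ▸ eraseLead_support_card_lt hp) p.eraseLead rfl
  rw [sort_support_eq_cons hp, List.map_cons, hcongr, signVariations_eq_eraseLead_add_ite hp,
    ← this]
  by_cases hq : p.eraseLead = 0
  · simp [hq, signVar, hp]
  rw [sort_support_eq_cons hq, List.map_cons, signVar, add_comm]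
  congr 1
  have := letterOf_eq_iff (leadingCoeff_ne_zero.2 hp) (leadingCoeff_ne_zero.2 hq)
  rw [leadingCoeff, leadingCoeff] at this ⊢
  by_cases h1 : letterOf (p.coeff p.natDegree) =
    letterOf (p.eraseLead.coeff p.eraseLead.natDegree)
  · rw [if_pos h1, if_neg (this.1 h1)]
  · rw [if_neg h1, if_pos (by tauto)]

/-- Where the normal form holds, the type of the formula is the word of signs of its domain. -/
theorem SVFormula.type_eq_of_normalForm_pos (φ : SVFormula) (t : ℝ)
    (h : ∀ a ∈ φ.normalForm.domain, 0 < a.eval t) :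
    φ.type = φ.domain.map (fun b => letterOf (b.eval t)) ∧ ∀ b ∈ φ.domain, b.eval t ≠ 0 := by
  have key : ∀ (ε : Letter) (b : ℝ[X]), 0 < (normalPoly ε b).eval t →
      ε = letterOf (b.eval t) ∧ b.eval t ≠ 0 := by
    rintro (_ | _) b hb <;> simp only [normalPoly, eval_neg, Left.neg_pos_iff] at hb
    · simp [letterOf, hb, hb.ne']
    · simp [letterOf, hb.le, hb.ne]
  induction φ with
  | comp ε b =>
    obtain ⟨h1, h2⟩ := key ε b (h _ (by simp [normalForm, domain]))
    simp [type, domain, ← h1, h2]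
  | conj φ ε b ih =>
    obtain ⟨h1, h2⟩ := key ε b (h _ (by simp [normalForm, domain]))
    obtain ⟨h3, h4⟩ := ih fun a ha => h a (by simp [normalForm, domain, ha])
    refine ⟨by simp [type, domain, ← h1, h3], ?_⟩
    simp only [domain, List.mem_append, List.mem_singleton]
    rintro a (ha | rfl)
    exacts [h4 a ha, h2]

/-- If `φ` is a sign variation formula for `f` that holds at `t`, no coefficient of `f` vanishes
at `t`, so that the type of `φ` has as many sign variations as the polynomial `f(t, ·)`. -/
theorem signVar_eq_signVariations {φ : SVFormula} {σ : List Letter} {f : ℝ[X][X]}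
    (hφ : φ.IsFor σ f) {t : ℝ} (h : ∀ a ∈ φ.normalForm.domain, 0 < a.eval t) :
    signVar σ = (f.map (evalRingHom t)).signVariations := by
  obtain ⟨h1, h2⟩ := φ.type_eq_of_normalForm_pos t h
  have hsupp : (f.map (evalRingHom t)).support = f.support := by
    ext k
    rw [mem_support_iff, mem_support_iff, coeff_map, coe_evalRingHom]
    refine ⟨fun hk h0 => hk (by rw [h0, eval_zero]), fun hk => h2 _ ?_⟩
    rw [hφ.2, coeffSeq, List.mem_map]
    exact ⟨k, by rwa [Finset.mem_sort, mem_support_iff], rfl⟩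
  rw [← signVar_letterOf, hsupp, ← hφ.1, h1, hφ.2, coeffSeq, List.map_map]
  simp [Function.comp_def]

end SuperFamily

/-! ### The negative eigenspace of a hermitian matrix -/

namespace Matrix.IsHermitian

variable {m : Type*} [Fintype m] [DecidableEq m] {M : Matrix m m ℂ}

/-- A hermitian matrix is negative definite on the span of its eigenvectors with negative
eigenvalues. The span is encoded as the common kernel of the coordinates along all the other
eigenvectors. -/
theorem exists_negDef_submodule (hM : M.IsHermitian) :
    ∃ W : Submodule ℂ (m → ℂ),
      (Finset.univ.filter fun i => hM.eigenvalues i < 0).card ≤ Module.finrank ℂ W ∧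
      ∀ v ∈ W, 0 ≤ star v ⬝ᵥ M *ᵥ v → v = 0 := by
  set U : Matrix m m ℂ := (hM.eigenvectorUnitary : Matrix m m ℂ) with hU
  have hUU : U * Uᴴ = 1 := by
    rw [← star_eq_conjTranspose]; exact Unitary.mul_star_self_of_mem hM.eigenvectorUnitary.2
  let g : (m → ℂ) →ₗ[ℂ] ({i // ¬ hM.eigenvalues i < 0} → ℂ) :=
    (LinearMap.funLeft ℂ ℂ Subtype.val).comp Uᴴ.mulVecLin
  have hspec : M = U * diagonal (fun i => (hM.eigenvalues i : ℂ)) * Uᴴ := by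
    conv_lhs => rw [hM.spectral_theorem, Unitary.conjStarAlgAut_apply]
    rfl
  refine ⟨LinearMap.ker g, ?_, fun v hv h0 => ?_⟩
  · have h1 := g.finrank_range_add_finrank_ker
    have h2 := Submodule.finrank_le (LinearMap.range g)
    rw [Module.finrank_fintype_fun_eq_card] at h1 h2
    rw [Fintype.card_subtype] at h2
    have h3 := Finset.card_filter_add_card_filter_not (s := (Finset.univ : Finset m))
      (fun i => hM.eigenvalues i < 0)
    rw [Finset.card_univ] at h3
    omega
  · have hw : ∀ i, ¬ hM.eigenvalues i < 0 → (Uᴴ *ᵥ v) i = 0 := fun i hi =>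
      congrFun (LinearMap.mem_ker.1 hv) ⟨i, hi⟩
    have hquad : star v ⬝ᵥ M *ᵥ v =
        ((∑ i, hM.eigenvalues i * Complex.normSq ((Uᴴ *ᵥ v) i) : ℝ) : ℂ) := by
      have : star v ⬝ᵥ M *ᵥ v =
          star (Uᴴ *ᵥ v) ⬝ᵥ diagonal (fun i => (hM.eigenvalues i : ℂ)) *ᵥ (Uᴴ *ᵥ v) := by
        conv_lhs => rw [hspec, ← mulVec_mulVec, ← mulVec_mulVec, dotProduct_mulVec]
        rw [star_mulVec, conjTranspose_conjTranspose]
      rw [this, dotProduct]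
      push_cast
      refine Finset.sum_congr rfl fun i _ => ?_
      rw [mulVec_diagonal, Pi.star_apply, Complex.star_def, Complex.normSq_eq_conj_mul_self]
      ring
    rw [hquad] at h0
    have h0' : 0 ≤ ∑ i, hM.eigenvalues i * Complex.normSq ((Uᴴ *ᵥ v) i) := by exact_mod_cast h0
    have hterm : ∀ i ∈ Finset.univ, hM.eigenvalues i * Complex.normSq ((Uᴴ *ᵥ v) i) ≤ 0 := by
      intro i _
      by_cases hi : hM.eigenvalues i < 0
      · exact mul_nonpos_of_nonpos_of_nonneg hi.le (Complex.normSq_nonneg _)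
      · rw [hw i hi, map_zero, mul_zero]
    have hzero := (Finset.sum_eq_zero_iff_of_nonpos hterm).1
      (le_antisymm (Finset.sum_nonpos hterm) h0')
    have hUv : Uᴴ *ᵥ v = 0 := by
      funext i
      by_cases hi : hM.eigenvalues i < 0
      · simpa [hi.ne] using hzero i (Finset.mem_univ i)
      · exact hw i hi
    rw [← one_mulVec v, ← hUU, ← mulVec_mulVec, hUv, mulVec_zero]

end Matrix.IsHermitian

/-! ### Negative eigenvalues of Choi-Jamiolkowski matrices -/

namespace SuperFamily

open Matrix

variable {n : ℕ}

/-- The Choi-Jamiolkowski matrix of a positive superoperator is nonnegative on product vectors. -/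
theorem Superoperator.IsPositive.cjMatrix_product_nonneg {Ψ : Superoperator n} (hΨ : Ψ.IsPositive)
    (a b : Fin n → ℂ) :
    0 ≤ star (fun p : Fin n × Fin n => a p.1 * b p.2) ⬝ᵥ
      cjMatrix Ψ *ᵥ (fun p : Fin n × Fin n => a p.1 * b p.2) := by
  -- The value is `b* Ψ(X) b` for the positive semidefinite matrix `X = conj(a) aᵀ`.
  have h1 :=
    (hΨ (vecMulVec (star a) a) (posSemidef_vecMulVec_star_self a)).dotProduct_mulVec_nonneg b
  convert h1 using 1
  have h2 : vecMulVec (star a) a = ∑ i, ∑ j, (star (a i) * a j) • single i j (1 : ℂ) := by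
    conv_lhs => rw [matrix_eq_sum_single (vecMulVec (star a) a)]
    simp [vecMulVec_apply, smul_single]
  rw [h2]
  simp only [map_sum, map_smul, dotProduct, mulVec, Fintype.sum_prod_type, cjMatrix_apply,
    Matrix.sum_apply, Matrix.smul_apply, Pi.star_apply, star_mul', Finset.mul_sum, Finset.sum_mul,
    smul_eq_mul]
  rw [Finset.sum_comm]
  refine Finset.sum_congr rfl fun k _ => ?_
  conv_rhs => rw [Finset.sum_comm]
  refine Finset.sum_congr rfl fun i _ => ?_
  conv_rhs => rw [Finset.sum_comm]
  refine Finset.sum_congr rfl fun j _ => Finset.sum_congr rfl fun l _ => ?_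
  ring

/-- A positive superoperator on `n × n` matrices has a Choi-Jamiolkowski matrix with at most
`(n - 1) ^ 2` negative eigenvalues. -/
theorem Superoperator.IsPositive.card_neg_eigenvalues_le {Ψ : Superoperator n} (hΨ : Ψ.IsPositive)
    (hM : (cjMatrix Ψ).IsHermitian) :
    ((Finset.univ.filter fun i => hM.eigenvalues i < 0).card : ℤ) ≤ (n : ℤ) ^ 2 - 2 * n + 1 := by
  obtain ⟨W, hW, hneg⟩ := hM.exists_negDef_submodule
  rcases Nat.eq_zero_or_pos n with rfl | hn
  · simp
  have : Nonempty (Fin n) := ⟨⟨0, hn⟩⟩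
  by_contra! hcon
  obtain ⟨a, b, ha, hb, hab⟩ := Segre.exists_product_mem W (by
    rw [Fintype.card_fin]
    zify at hW ⊢
    nlinarith)
  obtain ⟨i, hi⟩ := Function.ne_iff.1 ha
  obtain ⟨j, hj⟩ := Function.ne_iff.1 hb
  have := congrFun (hneg _ hab (hΨ.cjMatrix_product_nonneg a b)) (i, j)
  simp only [Pi.zero_apply, mul_eq_zero] at this
  exact this.elim hi hj

theorem OneParameterFamily.isHermitian_cjMatrix (Φ : OneParameterFamily n) (t : ℝ) :
    (cjMatrix (Φ.toFun t)).IsHermitian := by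
  obtain ⟨s, α, A, -, -, hΦ⟩ := Φ.exists_rep
  have h : ∀ X, (Φ.toFun t X)ᴴ = Φ.toFun t Xᴴ := by
    intro X
    rw [hΦ, hΦ, conjTranspose_sum]
    refine Finset.sum_congr rfl fun r _ => ?_
    simp [conjTranspose_smul, conjTranspose_mul, Matrix.mul_assoc]
  ext p q
  rw [conjTranspose_apply, cjMatrix_apply, cjMatrix_apply, ← conjTranspose_apply, h]
  simp

theorem detSubX_comp_neg_X {m : Type*} [Fintype m] [DecidableEq m] {M : Matrix m m ℂ}
    (hM : M.IsHermitian) :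
    (detSubX M).comp (-X) = ∏ i, (X + C (hM.eigenvalues i : ℂ)) := by
  have h1 : detSubX M = (-1) ^ Fintype.card m * M.charpoly := by
    rw [detSubX, charpoly, ← det_neg]
    congr 1
    ext1 i j
    by_cases hij : i = j <;> simp [hij]
  rw [h1, hM.charpoly_eq, mul_comp, prod_comp, ← Finset.card_univ, ← Finset.prod_const, prod_comp,
    ← Finset.prod_mul_distrib]
  refine Finset.prod_congr rfl fun i _ => ?_
  simp
  ring

theorem OneParameterFamily.reflCharPoly_map (Φ : OneParameterFamily n) (t : ℝ) :
    Φ.reflCharPoly.map (evalRingHom t) =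
      ∏ i, (X - C (-(Φ.isHermitian_cjMatrix t).eigenvalues i)) := by
  apply Polynomial.map_injective _ (algebraMap ℝ ℂ).injective
  rw [reflCharPoly, Polynomial.map_comp, Polynomial.map_comp, Φ.charPoly_spec, superCharPoly,
    Polynomial.map_neg, Polynomial.map_X, Polynomial.map_neg, Polynomial.map_X,
    detSubX_comp_neg_X (Φ.isHermitian_cjMatrix t), Polynomial.map_prod]
  simp

/-- The polynomial `χ⁻(t, ·)` has at most as many sign variations as the Choi-Jamiolkowski matrix of
`Φ t` has negative eigenvalues. -/
theorem OneParameterFamily.signVariations_reflCharPoly_le (Φ : OneParameterFamily n) (t : ℝ) :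
    (Φ.reflCharPoly.map (evalRingHom t)).signVariations ≤
      (Finset.univ.filter fun i => (Φ.isHermitian_cjMatrix t).eigenvalues i < 0).card := by
  rw [reflCharPoly_map]
  have h0 : ∏ i, (X - C (-(Φ.isHermitian_cjMatrix t).eigenvalues i)) ≠ 0 :=
    Finset.prod_ne_zero_iff.2 fun i _ => X_sub_C_ne_zero _
  refine (signVariations_le_countP_pos_of_splits
    (Splits.prod fun i _ => Splits.X_sub_C _)).trans (le_of_eq ?_)
  rw [roots_prod _ _ h0]
  simp only [roots_X_sub_C, Multiset.bind_singleton, Multiset.countP_map, Left.neg_pos_iff]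
  rfl

theorem not_isPositive_of_normalForm_pos {Φ : OneParameterFamily n} {σ : List Letter}
    {φ : SVFormula} (hφ : φ.IsFor σ Φ.reflCharPoly)
    (hσ : (n : ℤ) ^ 2 - 2 * (n : ℤ) + 2 ≤ (signVar σ : ℤ)) {t : ℝ}
    (h : ∀ a ∈ φ.normalForm.domain, 0 < a.eval t) : ¬ (Φ.toFun t).IsPositive := by
  intro hpos
  have h1 := hpos.card_neg_eigenvalues_le (Φ.isHermitian_cjMatrix t)
  have h2 := Φ.signVariations_reflCharPoly_le t
  rw [← signVar_eq_signVariations hφ h] at h2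
  zify at h2
  linarith

/-! ### Where the normal form holds -/

/-- A polynomial which is positive at `0` and has no real roots is positive everywhere. -/
theorem eval_pos_of_rootDiff_one {a : ℝ[X]} (h : rootDiff a 1 = 0) (h0 : 0 < a.eval 0) (t : ℝ) :
    0 < a.eval t := by
  have ha : a ≠ 0 := by rintro rfl; simp at h0
  have hroot : ∀ x, a.eval x ≠ 0 := by
    -- `Set.ncard` is `0` for infinite sets as well, so finiteness of the root set is needed here.
    have hfin : {x : ℝ | a.eval x = 0}.Finite :=
      (a.roots.toFinset.finite_toSet).subset fun x hx => by simpa [ha] using hx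
    simp only [rootDiff, eval_one, zero_lt_one, and_true, not_lt_of_ge zero_le_one, and_false,
      Set.ofPred_false, Set.ncard_empty, Nat.cast_zero, sub_zero, Nat.cast_eq_zero,
      Set.ncard_eq_zero hfin] at h
    exact fun x hx => Set.eq_empty_iff_forall_notMem.1 h x hx
  by_contra! hle
  obtain ⟨x, -, hx⟩ := intermediate_value_uIcc (a := t) (b := 0) a.continuous.continuousOn
    (Set.mem_uIcc.2 (Or.inl ⟨hle, h0.le⟩))
  exact hroot x hx

/-- The set where a normal form holds is open. -/
theorem eventually_normalForm_pos {l : List ℝ[X]} {t : ℝ} (h : ∀ a ∈ l, 0 < a.eval t) :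
    ∀ᶠ x in nhds t, ∀ a ∈ l, 0 < a.eval x :=
  (Filter.eventually_all_finite l.finite_toSet).2 fun a ha =>
    a.continuous.continuousAt.eventually (lt_mem_nhds (h a ha))

end SuperFamily

/-! ### Conclusion -/

theorem theorem7p1 (n : ℕ) (Φ : SuperFamily.OneParameterFamily n)
    (σ : List SuperFamily.Letter) (φ : SuperFamily.SVFormula)
    (hφ : φ.IsFor σ Φ.reflCharPoly)
    (hσ : (n : ℤ) ^ 2 - 2 * (n : ℤ) + 2 ≤ (SuperFamily.signVar σ : ℤ)) :
    ((∀ a ∈ φ.normalForm.domain, SuperFamily.rootDiff a 1 = 0 ∧ 0 < a.eval 0) →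
      Φ.GloballyNonpositive) ∧
    (((∀ a ∈ φ.normalForm.domain, Tendsto (fun t : ℝ => a.eval t) atTop atTop) ∨
      (∀ a ∈ φ.normalForm.domain, Tendsto (fun t : ℝ => a.eval t) atBot atTop) ∨
      (SuperFamily.rootSetPos (derivative φ.normalForm.domain.prod)
        φ.normalForm.domain).encard ≠ 0) →
      Φ.PointwiseNonpositive ∧ Φ.LocallyNonpositive) := by
  refine ⟨fun h t => SuperFamily.not_isPositive_of_normalForm_pos hφ hσ fun a ha =>
    SuperFamily.eval_pos_of_rootDiff_one (h a ha).1 (h a ha).2 t, fun h => ?_⟩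
  obtain ⟨t, ht⟩ : ∃ t : ℝ, ∀ a ∈ φ.normalForm.domain, 0 < a.eval t := by
    have hlim : ∀ l : Filter ℝ, l.NeBot →
        (∀ a ∈ φ.normalForm.domain, Tendsto (fun t : ℝ => a.eval t) l atTop) →
        ∃ t : ℝ, ∀ a ∈ φ.normalForm.domain, 0 < a.eval t := fun l _ hl =>
      ((Filter.eventually_all_finite φ.normalForm.domain.finite_toSet).2 fun a ha =>
        (hl a ha).eventually_gt_atTop 0).exists
    rcases h with h | h | h
    · exact hlim atTop inferInstance h
    · exact hlim atBot inferInstance h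
    · obtain ⟨t, -, ht⟩ := Set.encard_ne_zero.1 h
      exact ⟨t, ht⟩
  refine ⟨⟨t, SuperFamily.not_isPositive_of_normalForm_pos hφ hσ ht⟩, ?_⟩
  obtain ⟨ε, hε, hball⟩ := Metric.eventually_nhds_iff_ball.1
    (SuperFamily.eventually_normalForm_pos ht)
  refine ⟨t - ε, t + ε, by linarith, fun x hx =>
    SuperFamily.not_isPositive_of_normalForm_pos hφ hσ (hball x ?_)⟩
  rwa [Real.ball_eq_Ioo]
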